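/- Let $K\ge 1$ and $n\ge 1$ be integers, let $\pi_0$ be a probability measure on a measurable space $\Theta$, and for $\theta\in\Theta$ and $i\in\{1,\dots,K\}$ let $\nu_i(\theta)$ be a probability distribution supported on $[0,1]$ and depending measurably on $\theta$, with mean $\mu_i(\theta)$. Let $\theta$ be a random variable with law $\pi_0$ and, for each arm $i$, let $(X_{i,s})_{s\ge 1}$ be random variables that, conditionally on $\theta$, are independent and identically distributed with law $\nu_i(\theta)$. In each round $t=1,2,\dots$ an arm $I_t\in\{1,\dots,K\}$ is pulled, and the $s$-th pull of arm $i$ yields the reward $X_{i,s}$; let $H_t$ denote the sequence of arms pulled and rewards received before round $t$. Thompson Sampling with prior $\pi_0$ is the following strategy: with $\pi_t$ the posterior distribution of $\theta$ given $H_t$ (a regular conditional distribution, assumed to exist, which is automatic when $\Theta$ is a standard Borel space), in round $t$ it draws $\theta^{(t)}$ from $\pi_t$, independently of the parameter $\theta$, the rewards and the earlier draws given $H_t$, and it pulls $I_t=i^*(\theta^{(t)})$, where $i^*:\Theta\to\{1,\dots,K\}$ is a fixed measurable map with $i^*(x)\in\operatorname{argmax}_{i}\mu_i(x)$ for all $x\in\Theta$.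 Then, for every such prior and reward distributions, the Bayesian regret of Thompson Sampling satisfies $$\mathrm{BR}_n=\mathbb{E}\sum_{t=1}^n\Big(\max_{1\le i\le K}\mu_i(\theta)-\mu_{I_t}(\theta)\Big)\le 14\sqrt{nK}.$$ -/

import Mathlib

open MeasureTheory ProbabilityTheory

namespace BayesBandit

noncomputable section

variable {Θ Ω : Type*} [MeasurableSpace Θ] [MeasurableSpace Ω] {K : ℕ}

/-- The mean `μ_i(θ)` of the reward distribution `ν_i(θ)` of arm `i` under the parameter `x`. -/
def meanReward (ν : Fin K → Kernel Θ ℝ) (i : Fin K) (x : Θ) : ℝ :=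
  ∫ y, y ∂(ν i x)

/-- The Bayesian bandit environment with `K` arms, prior `π₀` and reward distributions
`ν_i(θ)` supported on `[0,1]`: the parameter `θ` has law `π₀`, and for each arm `i`,
conditionally on `θ`, the rewards `X i 0, X i 1, …` are i.i.d. with law `ν_i(θ)`.
Nothing is imposed on the joint behaviour of the rewards of different arms. -/
structure IsEnvironment (P : Measure Ω) (π₀ : Measure Θ) (ν : Fin K → Kernel Θ ℝ)
    (θ : Ω → Θ) (X : Fin K → ℕ → Ω → ℝ) : Prop where
  measurable_param : Measurable θ
  measurable_reward : ∀ i s, Measurable (X i s)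
  supported : ∀ i x, ν i x (Set.Icc 0 1) = 1
  law_param : P.map θ = π₀
  cond_iid : ∀ (i : Fin K) (m : ℕ) (A : Set Θ) (B : Fin m → Set ℝ), MeasurableSet A →
    (∀ s, MeasurableSet (B s)) →
    P {ω | θ ω ∈ A ∧ ∀ s : Fin m, X i s ω ∈ B s} = ∫⁻ x in A, ∏ s, ν i x (B s) ∂π₀

/-- The number of pulls of arm `i` in the rounds before round `t` (rounds are `0, 1, …`). -/
def pulls (I : ℕ → Ω → Fin K) (i : Fin K) (t : ℕ) (ω : Ω) : ℕ :=
  ((Finset.range t).filter fun s => I s ω = i).card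

/-- The reward received in round `t`: the `s`-th pull of an arm `i` (counted from `0`)
yields `X i s`. -/
def received (X : Fin K → ℕ → Ω → ℝ) (I : ℕ → Ω → Fin K) (t : ℕ) (ω : Ω) : ℝ :=
  X (I t ω) (pulls I (I t ω) t ω) ω

/-- The history up to the beginning of round `t`: the arms pulled and the rewards received
in the rounds `s < t`. -/
def history (X : Fin K → ℕ → Ω → ℝ) (I : ℕ → Ω → Fin K) (t : ℕ) (ω : Ω) :
    Fin t → Fin K × ℝ :=
  fun s => (I s ω, received X I s ω)

/-- Everything generated before the draw of round `t`, with the history as first component: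
the history, the parameter, all the rewards and the earlier draws. -/
def past (θ : Ω → Θ) (X : Fin K → ℕ → Ω → ℝ) (draw : ℕ → Ω → Θ) (I : ℕ → Ω → Fin K)
    (t : ℕ) (ω : Ω) : (Fin t → Fin K × ℝ) × Θ × (Fin K → ℕ → ℝ) × (Fin t → Θ) :=
  (history X I t ω, θ ω, fun i s => X i s ω, fun s => draw s ω)

/-- `I` is the sequence of arms pulled by Thompson Sampling, where `post t` is the posterior
distribution `π_t` of `θ` given the history, `draw t` is the sampled parameter `θ^(t)`, and
`best` is the choice of an optimal arm for each parameter. -/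
structure IsThompsonSampling (P : Measure Ω) (ν : Fin K → Kernel Θ ℝ)
    (θ : Ω → Θ) (X : Fin K → ℕ → Ω → ℝ) (best : Θ → Fin K)
    (post : (t : ℕ) → Kernel (Fin t → Fin K × ℝ) Θ) (draw : ℕ → Ω → Θ)
    (I : ℕ → Ω → Fin K) : Prop where
  measurable_best : Measurable best
  best_optimal : ∀ x i, meanReward ν i x ≤ meanReward ν (best x) x
  measurable_draw : ∀ t, Measurable (draw t)
  /-- `post t` is the conditional distribution of `θ` given the history. -/
  posterior : ∀ t, HasCondDistrib θ (history X I t) (post t) P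
  /-- `draw t` is sampled from `post t` at the observed history, independently of everything
  else so far: given the history, the parameter, all the rewards and the earlier draws, its
  conditional distribution is `post t` at the history. -/
  sampling : ∀ t, HasCondDistrib (draw t) (past θ X draw I t)
    ((post t).comap Prod.fst (measurable_fst :
      Measurable (Prod.fst : (Fin t → Fin K × ℝ) × Θ × (Fin K → ℕ → ℝ) × (Fin t → Θ) → _))) P
  /-- The arm pulled is the optimal arm of the sampled parameter. -/
  pull : ∀ t ω, I t ω = best (draw t ω)

/-- The Bayesian regret over `n` rounds (for rewards in `[0,1]` and measurable `θ` and `I`,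
the integrand is measurable with values in `[0,n]`). -/
def bayesRegret (P : Measure Ω) (ν : Fin K → Kernel Θ ℝ) (θ : Ω → Θ)
    (I : ℕ → Ω → Fin K) (n : ℕ) : ℝ :=
  ∫ ω, ∑ t ∈ Finset.range n,
    ((⨆ i, meanReward ν i (θ ω)) - meanReward ν (I t ω) (θ ω)) ∂P

end

end BayesBandit

/-! The argument compares Thompson Sampling with an index it never uses: empirical mean plus the
bonus `M s^(-3/4)` after `s` pulls, with `M = (n/K)^(1/4)`. This index is a function of the history,
and given the history the sampled parameter has the law of the true one (`map_history_draw`). Hence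
in every round the index of the optimal arm and the index of the pulled arm have equal expectation
(`integral_index_eq`), and the regret splits into the underestimation of the optimal arm and the
overestimation of the pulled arm (`bayesRegret_eq`).

Both parts rest on one maximal inequality, `lintegral_maxExcess_le`: if the steps of a random walk
have exponential moment at most one, the expected largest excess over level `z` is at most `exp
(-z)`. By Hoeffding's lemma it applies, conditionally on the parameter, to tilted and compensated
reward sums. Maximising over all sample sizes up to the horizon disposes of the random, adaptively
chosen pull counts, and the optimal arm depends on the parameter alone, so no union bound over arms
is needed.

Underestimation: dyadic blocks of sample sizes give at most `6.3 / M^2` per round. Overestimation: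
the sum over rounds is regrouped by arm; the bonuses sum to a bound affine in the pull count, and
the deviations above a slack `ε` form a convergent series. With `R = √(nK) = n / M^2 = K M^2` and `ε
= 1 / M^2`, everything is a multiple of `R`, with total below `14 R` once `K ≤ n`; for `n < K` the
trivial bound `n` suffices. -/

namespace BayesBandit

set_option linter.unusedSectionVars false

/-! ### Maximal inequality for random walks and Hoeffding's lemma -/

/-- The largest excess `(w 0 + ⋯ + w (s - 1) - z)⁺` over `s ≤ N`. -/
noncomputable def maxExcess : (N : ℕ) → (Fin N → ℝ) → ℝ → ℝ
  | 0, _, z => max (-z) 0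
  | N + 1, w, z => max (max (-z) 0) (maxExcess N (fun k => w k.succ) (z - w 0))

lemma maxExcess_nonneg (N : ℕ) (w : Fin N → ℝ) (z : ℝ) : 0 ≤ maxExcess N w z := by
  cases N with
  | zero => exact le_max_right _ _
  | succ N => exact (le_max_right _ _).trans (le_max_left _ _)

lemma continuous_maxExcess (N : ℕ) :
    Continuous fun p : (Fin N → ℝ) × ℝ => maxExcess N p.1 p.2 := by
  induction N with
  | zero => simp only [maxExcess]; fun_prop
  | succ N ih =>
    simp only [maxExcess]
    refine Continuous.max (by fun_prop) ?_
    exact ih.comp (f := fun p : (Fin (N + 1) → ℝ) × ℝ =>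
      ((fun k : Fin N => p.1 k.succ), p.2 - p.1 0)) (by fun_prop)

@[fun_prop]
lemma measurable_maxExcess {α : Type*} [MeasurableSpace α] {N : ℕ} {f : α → Fin N → ℝ} {g : α → ℝ}
    (hf : Measurable f) (hg : Measurable g) : Measurable fun a => maxExcess N (f a) (g a) :=
  (continuous_maxExcess N).measurable.comp (hf.prodMk hg)

lemma sum_sub_le_maxExcess {N s : ℕ} (hs : s ≤ N) (w : ℕ → ℝ) (z : ℝ) :
    ∑ k ∈ Finset.range s, w k - z ≤ maxExcess N (fun k => w k) z := by
  induction N generalizing s w z with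
  | zero =>
    obtain rfl : s = 0 := by omega
    simp [maxExcess]
  | succ N ih =>
    rcases s with _ | s
    · simp [maxExcess]
    · refine le_trans ?_ (le_max_right _ _)
      have := ih (s := s) (by omega) (fun k => w (k + 1)) (z - w 0)
      rw [Finset.sum_range_succ']
      simp only [Fin.val_zero, Fin.val_succ]
      linarith

lemma maxExcess_le_sub (N : ℕ) (w : Fin N → ℝ) {z z' : ℝ} (h : z ≤ z') :
    maxExcess N w z ≤ maxExcess N w z' + (z' - z) := by
  induction N generalizing z z' with
  | zero =>
    simp only [maxExcess]
    rcases max_cases (-z) 0 with h1 | h1 <;> rcases max_cases (-z') 0 with h2 | h2 <;> linarith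
  | succ N ih =>
    have := ih (fun k => w k.succ) (sub_le_sub_right h (w 0))
    simp only [maxExcess]
    refine max_le (max_le ?_ ?_) ?_
    · have h1 : -z' ≤ max (max (-z') 0) (maxExcess N (fun k => w k.succ) (z' - w 0)) :=
        (le_max_left _ _).trans (le_max_left _ _)
      linarith
    · have h1 : 0 ≤ max (max (-z') 0) (maxExcess N (fun k => w k.succ) (z' - w 0)) :=
        (le_max_right _ _).trans (le_max_left _ _)
      linarith
    · have h1 : maxExcess N (fun k => w k.succ) (z' - w 0) ≤
        max (max (-z') 0) (maxExcess N (fun k => w k.succ) (z' - w 0)) := le_max_right _ _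
      linarith

/-- A maximal inequality for the exponential supermartingale of a random walk. -/
lemma lintegral_maxExcess_le (N : ℕ) (ν : Measure ℝ) [IsProbabilityMeasure ν] {v : ℝ → ℝ}
    (hv : Measurable v) (hexp : ∫⁻ y, ENNReal.ofReal (Real.exp (v y)) ∂ν ≤ 1) (z : ℝ) :
    ∫⁻ y, ENNReal.ofReal (maxExcess N (fun k => v (y k)) z) ∂(Measure.pi fun _ : Fin N => ν)
      ≤ ENNReal.ofReal (Real.exp (-z)) := by
  induction N generalizing z with
  | zero =>
    simp only [maxExcess, lintegral_const, measure_univ, mul_one]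
    refine ENNReal.ofReal_le_ofReal (max_le ?_ (Real.exp_pos _).le)
    linarith [Real.add_one_le_exp (-z)]
  | succ N ih =>
    have main : ∀ z : ℝ, 0 ≤ z → ∫⁻ y, ENNReal.ofReal (maxExcess (N + 1) (fun k => v (y k)) z)
        ∂(Measure.pi fun _ : Fin (N + 1) => ν) ≤ ENNReal.ofReal (Real.exp (-z)) := by
      intro z hz
      have hmeas : Measurable fun p : ℝ × (Fin N → ℝ) =>
          ENNReal.ofReal (maxExcess N (fun k => v (p.2 k)) (z - v p.1)) := by fun_prop
      have hmp := measurePreserving_piFinSuccAbove (fun _ : Fin (N + 1) => ν) 0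
      calc ∫⁻ y, ENNReal.ofReal (maxExcess (N + 1) (fun k => v (y k)) z)
            ∂(Measure.pi fun _ : Fin (N + 1) => ν)
          = ∫⁻ y, ENNReal.ofReal (maxExcess N (fun k : Fin N => v (y k.succ)) (z - v (y 0)))
            ∂(Measure.pi fun _ : Fin (N + 1) => ν) := by
            -- At a level `z ≥ 0` the empty sum has no excess, so only the walk restarted after its
            -- first step counts.
            refine lintegral_congr fun y => ?_
            simp only [maxExcess]
            rw [max_eq_right (a := -z) (by linarith), max_eq_right (maxExcess_nonneg _ _ _)]
        _ = ∫⁻ p, ENNReal.ofReal (maxExcess N (fun k => v (p.2 k)) (z - v p.1))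
            ∂(ν.prod (Measure.pi fun _ : Fin N => ν)) := by
            rw [← hmp.lintegral_comp hmeas]
            rfl
        _ = ∫⁻ x, ∫⁻ y, ENNReal.ofReal (maxExcess N (fun k => v (y k)) (z - v x))
            ∂(Measure.pi fun _ : Fin N => ν) ∂ν := lintegral_prod _ hmeas.aemeasurable
        _ ≤ ∫⁻ x, ENNReal.ofReal (Real.exp (-z)) * ENNReal.ofReal (Real.exp (v x)) ∂ν := by
            refine lintegral_mono fun x => (ih _).trans_eq ?_
            rw [← ENNReal.ofReal_mul (Real.exp_pos _).le, ← Real.exp_add]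
            ring_nf
        _ ≤ ENNReal.ofReal (Real.exp (-z)) := by
            rw [lintegral_const_mul _ (by fun_prop)]
            exact mul_le_of_le_one_right' hexp
    rcases le_or_gt 0 z with hz | hz
    · exact main z hz
    -- Below zero, the excess grows by at most `-z` over its value at level `0`, and `1 - z ≤ exp
    -- (-z)`.
    · calc ∫⁻ y, ENNReal.ofReal (maxExcess (N + 1) (fun k => v (y k)) z)
            ∂(Measure.pi fun _ : Fin (N + 1) => ν)
          ≤ ∫⁻ y, (ENNReal.ofReal (maxExcess (N + 1) (fun k => v (y k)) 0) + ENNReal.ofReal (-z))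
            ∂(Measure.pi fun _ : Fin (N + 1) => ν) := by
            refine lintegral_mono fun y => ?_
            rw [← ENNReal.ofReal_add (maxExcess_nonneg _ _ _) (by linarith)]
            refine ENNReal.ofReal_le_ofReal ?_
            have := maxExcess_le_sub (N + 1) (fun k => v (y k)) hz.le
            linarith
        _ ≤ ENNReal.ofReal (Real.exp (-0)) + ENNReal.ofReal (-z) := by
            rw [lintegral_add_right _ (by fun_prop)]
            refine add_le_add (main 0 le_rfl) (by simp)
        _ ≤ ENNReal.ofReal (Real.exp (-z)) := by
            rw [← ENNReal.ofReal_add (Real.exp_pos _).le (by linarith)]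
            refine ENNReal.ofReal_le_ofReal ?_
            have := Real.add_one_le_exp (-z)
            simp only [neg_zero, Real.exp_zero]
            linarith

/-- Hoeffding's lemma, normalised to an exponential moment of at most one. -/
lemma lintegral_exp_centred_le_one (ν : Measure ℝ) [IsProbabilityMeasure ν]
    (hν : ν (Set.Icc 0 1) = 1) (t : ℝ) :
    ∫⁻ y, ENNReal.ofReal (Real.exp (t * (y - ∫ y, y ∂ν) - t ^ 2 / 8)) ∂ν ≤ 1 := by
  have hae : ∀ᵐ y ∂ν, y ∈ Set.Icc (0 : ℝ) 1 := by
    rw [← prob_compl_eq_zero_iff measurableSet_Icc] at hν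
    exact hν
  have h := hasSubgaussianMGF_of_mem_Icc (μ := ν) (X := fun y => y) aemeasurable_id hae
  have hint := h.integrable_exp_mul t
  have hle := h.mgf_le t
  have heq : ∀ y : ℝ, Real.exp (t * (y - ∫ y, y ∂ν) - t ^ 2 / 8)
      = Real.exp (t * (y - ∫ y, y ∂ν)) * Real.exp (-(t ^ 2 / 8)) := fun y => by
    rw [← Real.exp_add, sub_eq_add_neg]
  simp only [heq]
  rw [← ofReal_integral_eq_lintegral_ofReal (hint.mul_const _)
    (ae_of_all _ fun y => by positivity), integral_mul_const, ← ENNReal.ofReal_one]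
  refine ENNReal.ofReal_le_ofReal ?_
  calc _ ≤ Real.exp (t ^ 2 / 8) * Real.exp (-(t ^ 2 / 8)) := by
        refine mul_le_mul_of_nonneg_right (hle.trans_eq ?_) (Real.exp_pos _).le
        congr 1
        norm_num
        ring
    _ = 1 := by rw [← Real.exp_add]; simp

/-! ### Excess bounds in the environment, conditionally on the parameter -/

section

/-- The law of `m` independent samples from a Markov kernel. -/
noncomputable def iidKernel {α : Type*} [MeasurableSpace α] (κ : Kernel α ℝ) [IsMarkovKernel κ]
    (m : ℕ) : Kernel α (Fin m → ℝ) where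
  toFun x := Measure.pi fun _ => κ x
  measurable' := by
    refine Measurable.measure_of_isPiSystem_of_isProbabilityMeasure generateFrom_pi.symm
      isPiSystem_pi ?_
    rintro _ ⟨B, hB, rfl⟩
    simp only [Set.mem_univ_pi, Set.mem_ofPred_eq] at hB
    simp only [Measure.pi_pi]
    exact Finset.measurable_prod _ fun s _ => κ.measurable_coe (hB s)

lemma iidKernel_apply {α : Type*} [MeasurableSpace α] (κ : Kernel α ℝ) [IsMarkovKernel κ]
    (m : ℕ) (x : α) : iidKernel κ m x = Measure.pi fun _ => κ x := rfl

instance {α : Type*} [MeasurableSpace α] (κ : Kernel α ℝ) [IsMarkovKernel κ] (m : ℕ) :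
    IsMarkovKernel (iidKernel κ m) :=
  ⟨fun x => by rw [iidKernel_apply]; infer_instance⟩

lemma measurable_meanReward {Θ : Type*} [MeasurableSpace Θ] {K : ℕ} (ν : Fin K → Kernel Θ ℝ)
    [∀ i, IsMarkovKernel (ν i)] (i : Fin K) : Measurable (meanReward ν i) :=
  (StronglyMeasurable.integral_kernel (κ := ν i) (f := fun y : ℝ => y)
    measurable_id.stronglyMeasurable).measurable

variable {Θ Ω : Type*} [MeasurableSpace Θ] [MeasurableSpace Ω] {K : ℕ}
  {P : Measure Ω} [IsProbabilityMeasure P] {π₀ : Measure Θ} [IsProbabilityMeasure π₀]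
  {ν : Fin K → Kernel Θ ℝ} [∀ i, IsMarkovKernel (ν i)]
  {θ : Ω → Θ} {X : Fin K → ℕ → Ω → ℝ}

lemma IsEnvironment.map_eq_compProd (hEnv : IsEnvironment P π₀ ν θ X) (i : Fin K) (m : ℕ) :
    P.map (fun ω => (θ ω, fun k : Fin m => X i k ω)) = π₀ ⊗ₘ iidKernel (ν i) m := by
  have hθ := hEnv.measurable_param
  have hX := hEnv.measurable_reward
  have hmeas : Measurable fun ω => (θ ω, fun k : Fin m => X i k ω) := by fun_prop
  have := Measure.isProbabilityMeasure_map (μ := P) hmeas.aemeasurable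
  refine MeasureTheory.ext_of_generate_finite
    (Set.image2 (· ×ˢ ·) {s : Set Θ | MeasurableSet s}
      (Set.pi Set.univ '' Set.pi Set.univ fun _ : Fin m => {s : Set ℝ | MeasurableSet s})) ?_
    (IsPiSystem.prod MeasurableSpace.isPiSystem_measurableSet isPiSystem_pi) ?_ (by simp)
  · refine (generateFrom_eq_prod MeasurableSpace.generateFrom_measurableSet generateFrom_pi
      isCountablySpanning_measurableSet ?_).symm
    exact ⟨fun _ => Set.univ, fun _ => ⟨fun _ => Set.univ, by simp, by simp⟩, Set.iUnion_const _⟩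
  · rintro _ ⟨A, hA, _, ⟨B, hB, rfl⟩, rfl⟩
    simp only [Set.mem_univ_pi, Set.mem_ofPred_eq] at hA hB
    have hBm := MeasurableSet.univ_pi hB
    rw [Measure.map_apply hmeas (hA.prod hBm), Measure.compProd_apply_prod hA hBm]
    simp only [iidKernel_apply, Measure.pi_pi]
    rw [← hEnv.cond_iid i m A B hA hB]
    congr 1
    ext ω
    simp

/-- A bound uniform in the parameter under the conditional law survives restriction to any event
determined by the parameter. The restriction is what later permits an arm chosen as a function of
the parameter. -/
lemma IsEnvironment.setLIntegral_le (hEnv : IsEnvironment P π₀ ν θ X) (i : Fin K) (m : ℕ)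
    {F : Θ → (Fin m → ℝ) → ENNReal} (hF : Measurable fun p : Θ × (Fin m → ℝ) => F p.1 p.2)
    {c : ENNReal} (hc : ∀ x, ∫⁻ y, F x y ∂(Measure.pi fun _ => ν i x) ≤ c)
    {A : Set Θ} (hA : MeasurableSet A) :
    ∫⁻ ω in θ ⁻¹' A, F (θ ω) (fun k => X i k ω) ∂P ≤ c * P (θ ⁻¹' A) := by
  have hθ := hEnv.measurable_param
  have hX := hEnv.measurable_reward
  have hmeas : Measurable fun ω => (θ ω, fun k : Fin m => X i k ω) := by fun_prop
  have h1 : ∫⁻ ω in θ ⁻¹' A, F (θ ω) (fun k => X i k ω) ∂P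
      = ∫⁻ p in A ×ˢ Set.univ, F p.1 p.2
        ∂(P.map fun ω => (θ ω, fun k : Fin m => X i k ω)) := by
    rw [setLIntegral_map (hA.prod MeasurableSet.univ) hF hmeas]
    congr 2
    ext ω
    simp
  rw [h1, hEnv.map_eq_compProd, Measure.setLIntegral_compProd hF hA MeasurableSet.univ,
    ← Measure.map_apply hθ hA, hEnv.law_param, ← setLIntegral_const]
  refine lintegral_mono fun x => ?_
  rw [Measure.restrict_univ]
  exact hc x

/-- The largest excess over `z` of the walk with steps `t (X_{i,k} - μ_i(θ)) - t² / 8`. -/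
noncomputable def armExcess (ν : Fin K → Kernel Θ ℝ) (θ : Ω → Θ) (X : Fin K → ℕ → Ω → ℝ)
    (i : Fin K) (N : ℕ) (t z : ℝ) (ω : Ω) : ℝ :=
  maxExcess N (fun k => t * (X i k ω - meanReward ν i (θ ω)) - t ^ 2 / 8) z

lemma armExcess_nonneg (i : Fin K) (N : ℕ) (t z : ℝ) (ω : Ω) : 0 ≤ armExcess ν θ X i N t z ω :=
  maxExcess_nonneg _ _ _

lemma sum_sub_le_armExcess (i : Fin K) {N s : ℕ} (hs : s ≤ N) (t z : ℝ) (ω : Ω) :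
    t * (∑ k ∈ Finset.range s, X i k ω - s * meanReward ν i (θ ω)) - s * (t ^ 2 / 8) - z
      ≤ armExcess ν θ X i N t z ω := by
  refine le_trans (le_of_eq ?_) (sum_sub_le_maxExcess hs
    (fun k => t * (X i k ω - meanReward ν i (θ ω)) - t ^ 2 / 8) z)
  simp [Finset.sum_sub_distrib, ← Finset.mul_sum]

lemma IsEnvironment.measurable_armExcess (hEnv : IsEnvironment P π₀ ν θ X) (i : Fin K) (N : ℕ)
    (t z : ℝ) : Measurable (armExcess ν θ X i N t z) := by
  have hθ := hEnv.measurable_param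
  have hX := hEnv.measurable_reward
  have hm := measurable_meanReward ν i
  unfold armExcess
  fun_prop

lemma IsEnvironment.setLIntegral_armExcess_le (hEnv : IsEnvironment P π₀ ν θ X) (i : Fin K)
    (N : ℕ) (t z : ℝ) {A : Set Θ} (hA : MeasurableSet A) :
    ∫⁻ ω in θ ⁻¹' A, ENNReal.ofReal (armExcess ν θ X i N t z ω) ∂P
      ≤ ENNReal.ofReal (Real.exp (-z)) * P (θ ⁻¹' A) := by
  have hm := measurable_meanReward ν i
  refine hEnv.setLIntegral_le i N
    (F := fun x y => ENNReal.ofReal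
      (maxExcess N (fun k => t * (y k - meanReward ν i x) - t ^ 2 / 8) z))
    (by fun_prop) (fun x => ?_) hA
  exact lintegral_maxExcess_le N (ν i x)
    (v := fun y => t * (y - meanReward ν i x) - t ^ 2 / 8) (by fun_prop)
    (lintegral_exp_centred_le_one (ν i x) (hEnv.supported i x) t) z

lemma IsEnvironment.integrable_armExcess (hEnv : IsEnvironment P π₀ ν θ X) (i : Fin K)
    (N : ℕ) (t z : ℝ) : Integrable (armExcess ν θ X i N t z) P := by
  refine ⟨(hEnv.measurable_armExcess i N t z).aestronglyMeasurable, ?_⟩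
  rw [hasFiniteIntegral_iff_ofReal (ae_of_all _ fun ω => armExcess_nonneg _ _ _ _ _)]
  have h := hEnv.setLIntegral_armExcess_le i N t z MeasurableSet.univ
  simp only [Set.preimage_univ, Measure.restrict_univ, measure_univ, mul_one] at h
  exact h.trans_lt ENNReal.ofReal_lt_top

lemma IsEnvironment.setIntegral_armExcess_le (hEnv : IsEnvironment P π₀ ν θ X) (i : Fin K)
    (N : ℕ) (t z : ℝ) {A : Set Θ} (hA : MeasurableSet A) :
    ∫ ω in θ ⁻¹' A, armExcess ν θ X i N t z ω ∂P ≤ Real.exp (-z) * P.real (θ ⁻¹' A) := by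
  have h := hEnv.setLIntegral_armExcess_le i N t z hA
  rw [integral_eq_lintegral_of_nonneg_ae (ae_of_all _ fun ω => armExcess_nonneg _ _ _ _ _)
    (hEnv.measurable_armExcess i N t z).aestronglyMeasurable]
  refine (ENNReal.toReal_mono (by finiteness) h).trans_eq ?_
  rw [ENNReal.toReal_mul, ENNReal.toReal_ofReal (Real.exp_pos _).le]
  rfl

lemma IsEnvironment.integral_armExcess_le (hEnv : IsEnvironment P π₀ ν θ X) (i : Fin K)
    (N : ℕ) (t z : ℝ) : ∫ ω, armExcess ν θ X i N t z ω ∂P ≤ Real.exp (-z) := by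
  simpa using hEnv.setIntegral_armExcess_le i N t z MeasurableSet.univ

/-- The events on which the optimal arm takes a given value are determined by the parameter, so the
conditional bound applies on each; their probabilities sum to one, and no factor `K` is lost. -/
lemma IsEnvironment.integral_armExcess_choice_le (hEnv : IsEnvironment P π₀ ν θ X)
    {best : Θ → Fin K} (hbest : Measurable best) (N : ℕ) (t z : ℝ) :
    Integrable (fun ω => armExcess ν θ X (best (θ ω)) N t z ω) P ∧
      ∫ ω, armExcess ν θ X (best (θ ω)) N t z ω ∂P ≤ Real.exp (-z) := by
  have hθ := hEnv.measurable_param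
  have hA : ∀ i, MeasurableSet (best ⁻¹' {i}) := fun i => hbest (measurableSet_singleton i)
  have heq : (fun ω => armExcess ν θ X (best (θ ω)) N t z ω) = fun ω => ∑ i,
      (θ ⁻¹' (best ⁻¹' {i})).indicator (armExcess ν θ X i N t z) ω := by
    ext ω
    rw [Finset.sum_eq_single (best (θ ω)) (fun i _ hi => Set.indicator_of_notMem (by simpa using hi.symm) _)
      (by simp), Set.indicator_of_mem (by simp)]
  have hint : ∀ i, Integrable ((θ ⁻¹' (best ⁻¹' {i})).indicator (armExcess ν θ X i N t z)) P :=
    fun i => (hEnv.integrable_armExcess i N t z).indicator (hθ (hA i))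
  rw [heq]
  refine ⟨integrable_finsetSum _ fun i _ => hint i, ?_⟩
  rw [integral_finsetSum _ fun i _ => hint i]
  calc _ ≤ ∑ i, Real.exp (-z) * P.real (θ ⁻¹' (best ⁻¹' {i})) := by
        refine Finset.sum_le_sum fun i _ => ?_
        rw [integral_indicator (hθ (hA i))]
        exact hEnv.setIntegral_armExcess_le i N t z (hA i)
    _ = Real.exp (-z) := by
        rw [← Finset.mul_sum]
        have := sum_measureReal_preimage_singleton (μ := P) (f := fun ω => best (θ ω)) Finset.univ
          (fun i _ => hθ (hA i))
        simp only [Finset.coe_univ, Set.preimage_univ, probReal_univ] at this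
        change _ * ∑ i, P.real ((fun ω => best (θ ω)) ⁻¹' {i}) = _
        rw [this, mul_one]

end

/-! ### Regrouping rounds by arm -/

section Counting

variable {Ω : Type*} {K : ℕ}

/-- Each round adds exactly one pair (arm, number of its earlier pulls), and these pairs fill an
initial segment for every arm. -/
lemma sum_range_pulls {E : Type*} [AddCommMonoid E] (I : ℕ → Ω → Fin K) (ω : Ω)
    (f : Fin K → ℕ → E) (n : ℕ) :
    ∑ t ∈ Finset.range n, f (I t ω) (pulls I (I t ω) t ω)
      = ∑ i, ∑ s ∈ Finset.range (pulls I i n ω), f i s := by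
  induction n with
  | zero => simp [pulls]
  | succ n ih =>
    have hstep : ∀ i, ∑ s ∈ Finset.range (pulls I i (n + 1) ω), f i s
        = ∑ s ∈ Finset.range (pulls I i n ω), f i s
          + if i = I n ω then f i (pulls I i n ω) else 0 := by
      intro i
      by_cases h : i = I n ω
      · have hp : pulls I i (n + 1) ω = pulls I i n ω + 1 := by
          simp [pulls, Finset.range_add_one, Finset.filter_insert, h]
        rw [hp, Finset.sum_range_succ, if_pos h]
      · have hp : pulls I i (n + 1) ω = pulls I i n ω := by
          simp [pulls, Finset.range_add_one, Finset.filter_insert, Ne.symm h]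
        rw [hp, if_neg h, add_zero]
    simp only [hstep, Finset.sum_add_distrib, Finset.sum_range_succ, ih]
    simp

lemma sum_pulls (I : ℕ → Ω → Fin K) (ω : Ω) (n : ℕ) : ∑ i, pulls I i n ω = n := by
  have := sum_range_pulls I ω (fun _ _ => (1 : ℕ)) n
  simpa using this.symm

lemma pulls_le (I : ℕ → Ω → Fin K) (i : Fin K) (t : ℕ) (ω : Ω) : pulls I i t ω ≤ t :=
  (Finset.card_filter_le _ _).trans (by simp)

lemma sum_received (X : Fin K → ℕ → Ω → ℝ) (I : ℕ → Ω → Fin K) (ω : Ω) (i : Fin K) (n : ℕ) :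
    ∑ t ∈ Finset.range n, (if I t ω = i then received X I t ω else 0)
      = ∑ s ∈ Finset.range (pulls I i n ω), X i s ω := by
  refine (sum_range_pulls I ω (fun j s => if j = i then X j s ω else 0) n).trans ?_
  rw [Finset.sum_eq_single i (fun j _ hj => by simp [hj]) (by simp)]
  simp

end Counting

/-! ### The exploration bonus and its sum -/

section Bonus

open Real

/-- The exploration bonus `M s^(-3/4)` after `s` pulls. -/
noncomputable def bonus (M : ℝ) (s : ℕ) : ℝ := if s = 0 then 1 else M / √√(s : ℝ) ^ 3

lemma sqrt_sqrt_pow_four {x : ℝ} (hx : 0 ≤ x) : √√x ^ 4 = x := by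
  rw [show (4 : ℕ) = 2 * 2 from rfl, pow_mul, sq_sqrt (sqrt_nonneg _), sq_sqrt hx]

lemma bonus_nonneg {M : ℝ} (hM : 0 ≤ M) (s : ℕ) : 0 ≤ bonus M s := by
  unfold bonus; split_ifs <;> positivity

lemma bonus_le {M : ℝ} (hM : 0 ≤ M) (s : ℕ) : bonus M s ≤ 1 + M := by
  unfold bonus
  split_ifs with h
  · linarith
  · have h1 : (1 : ℝ) ≤ s := by exact_mod_cast Nat.one_le_iff_ne_zero.mpr h
    have h2 : (1 : ℝ) ≤ √√(s : ℝ) := one_le_sqrt.mpr (one_le_sqrt.mpr h1)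
    have := div_le_self hM (one_le_pow₀ h2 (n := 3))
    linarith

/-- Telescoping form of `∫ x^(-3/4) dx = 4 x^(1/4)`, obtained by factoring `u^4 - v^4 = 1`. -/
lemma one_div_sqrt_sqrt_cube_le (s : ℕ) :
    1 / √√((s + 1 : ℕ) : ℝ) ^ 3 ≤ 4 * (√√((s + 1 : ℕ) : ℝ) - √√(s : ℝ)) := by
  set u := √√((s + 1 : ℕ) : ℝ) with hu
  set v := √√(s : ℝ) with hv
  have hv0 : 0 ≤ v := sqrt_nonneg _
  have hvu : v ≤ u := sqrt_le_sqrt (sqrt_le_sqrt (by push_cast; linarith))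
  have hu0 : 0 < u := sqrt_pos.mpr (sqrt_pos.mpr (by positivity))
  have hu4 : u ^ 4 = s + 1 := by rw [hu, sqrt_sqrt_pow_four (by positivity)]; push_cast; ring
  have hv4 : v ^ 4 = s := sqrt_sqrt_pow_four (by positivity)
  rw [div_le_iff₀ (by positivity)]
  have h1 : v ^ 2 ≤ u ^ 2 := pow_le_pow_left₀ hv0 hvu 2
  have h2 : (u + v) * (u ^ 2 + v ^ 2) ≤ 4 * u ^ 3 :=
    calc (u + v) * (u ^ 2 + v ^ 2) ≤ (u + u) * (u ^ 2 + u ^ 2) := by gcongr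
      _ = 4 * u ^ 3 := by ring
  have h3 := mul_le_mul_of_nonneg_left h2 (sub_nonneg.mpr hvu)
  nlinarith

/-- The sum is of order `4 M N^(1/4)`. It is relaxed to an expression affine in `N` so that summing
over arms uses only that the pull counts add up to `n`. -/
lemma sum_bonus_le {M : ℝ} (hM : 0 < M) (N : ℕ) :
    ∑ s ∈ Finset.range N, bonus M s ≤ 1 + 3 * M ^ 2 + N / M ^ 2 := by
  have h : ∀ N : ℕ, ∑ s ∈ Finset.range (N + 1), bonus M s ≤ 1 + 4 * M * √√(N : ℝ) := by
    intro N
    induction N with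
    | zero => simp [bonus]
    | succ N ih =>
      rw [Finset.sum_range_succ]
      have := mul_le_mul_of_nonneg_left (one_div_sqrt_sqrt_cube_le N) hM.le
      have hb : bonus M (N + 1) = M * (1 / √√((N + 1 : ℕ) : ℝ) ^ 3) := by
        simp [bonus, div_eq_mul_inv]
      rw [hb]
      linarith
  -- AM-GM for `M^2, M^2, M^2, x^4 / M^2`, applied with `x = N^(1/4)`.
  have h4 : ∀ x : ℝ, 4 * M * x ≤ 3 * M ^ 2 + x ^ 4 / M ^ 2 := by
    intro x
    have : 3 * M ^ 2 + x ^ 4 / M ^ 2 - 4 * M * x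
        = ((x - M) ^ 2 * ((x + M) ^ 2 + 2 * M ^ 2)) / M ^ 2 := by
      field_simp
      ring
    have h0 : 0 ≤ ((x - M) ^ 2 * ((x + M) ^ 2 + 2 * M ^ 2)) / M ^ 2 := by positivity
    linarith
  rcases N with _ | N
  · simp; positivity
  · refine (h N).trans ?_
    have h5 := h4 √√(N : ℝ)
    rw [sqrt_sqrt_pow_four (by positivity)] at h5
    have : (N : ℝ) / M ^ 2 ≤ ((N + 1 : ℕ) : ℝ) / M ^ 2 := by
      gcongr; simp
    linarith

end Bonus

/-! ### Numerical series -/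

section Series

open Real

/-- Comparison with `∫ exp (-a√x) / (2√x) dx = 1 / a`, telescoped. The term `s = 0` vanishes because
`1 / 0 = 0`. -/
lemma sum_exp_neg_sqrt_le {a : ℝ} (ha : 0 < a) (N : ℕ) :
    ∑ s ∈ Finset.range N, 1 / (2 * √(s : ℝ)) * exp (-(a * √(s : ℝ))) ≤ 1 / a := by
  have hstep : ∀ s : ℕ, 1 / (2 * √((s + 1 : ℕ) : ℝ)) * exp (-(a * √((s + 1 : ℕ) : ℝ)))
      ≤ (exp (-(a * √(s : ℝ))) - exp (-(a * √((s + 1 : ℕ) : ℝ)))) / a := by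
    intro s
    set u := √((s + 1 : ℕ) : ℝ) with hu
    set v := √(s : ℝ) with hv
    have hv0 : 0 ≤ v := sqrt_nonneg _
    have hvu : v ≤ u := sqrt_le_sqrt (by push_cast; linarith)
    have hu0 : 0 < u := sqrt_pos.mpr (by positivity)
    have hu2 : u ^ 2 = s + 1 := by rw [hu, sq_sqrt (by positivity)]; push_cast; ring
    have hv2 : v ^ 2 = s := sq_sqrt (by positivity)
    have h1 : 1 / (2 * u) ≤ u - v := by
      rw [div_le_iff₀ (by positivity)]
      nlinarith
    have h2 : exp (-(a * v)) = exp (-(a * u)) * exp (a * (u - v)) := by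
      rw [← exp_add]; ring_nf
    have h3 := add_one_le_exp (a * (u - v))
    rw [le_div_iff₀ ha, h2]
    have h4 := mul_le_mul_of_nonneg_left h3 (exp_pos (-(a * u))).le
    have h5 := mul_le_mul_of_nonneg_right h1 (mul_pos (exp_pos (-(a * u))) ha).le
    linarith
  have h : ∀ N : ℕ, ∑ s ∈ Finset.range (N + 1), 1 / (2 * √(s : ℝ)) * exp (-(a * √(s : ℝ)))
      ≤ (1 - exp (-(a * √(N : ℝ)))) / a := by
    intro N
    induction N with
    | zero => simp
    | succ N ih =>
      rw [Finset.sum_range_succ]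
      refine (add_le_add ih (hstep N)).trans_eq ?_
      ring
  rcases N with _ | N
  · simp [ha.le]
  · refine (h N).trans ?_
    gcongr
    linarith [exp_pos (-(a * √(N : ℝ)))]

lemma sum_pow_lt_le {r M : ℝ} (hr : 1 < r) (hM : 0 < M) (J : ℕ) :
    ∑ j ∈ Finset.range J, (if r ^ j < M then r ^ j else 0) ≤ r * M / (r - 1) := by
  have hr1 : 0 < r - 1 := by linarith
  -- The minimum makes the induction close: the sum grows like `r ^ J` until the powers reach `M`,
  -- then stays fixed, the last step leading to a power below `r * M`.
  have h : ∑ j ∈ Finset.range J, (if r ^ j < M then r ^ j else 0)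
      ≤ min (r ^ J) (r * M) / (r - 1) := by
    induction J with
    | zero =>
      simp only [Finset.range_zero, Finset.sum_empty]
      positivity
    | succ J ih =>
      rw [Finset.sum_range_succ]
      rw [le_div_iff₀ hr1] at ih ⊢
      have hJ : 0 < r ^ J := by positivity
      split_ifs with hlt
      · have h1 := ih.trans (min_le_left _ _)
        refine le_min ?_ ?_
        · rw [pow_succ]; nlinarith
        · nlinarith
      · rw [add_zero]
        refine ih.trans (min_le_min_right _ ?_)
        rw [pow_succ]; nlinarith
  refine h.trans ?_
  gcongr
  exact min_le_right _ _

lemma sum_inv_pow_ge_le {r M : ℝ} (hr : 1 < r) (hM : 0 < M) (J : ℕ) :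
    ∑ j ∈ Finset.range J, (if r ^ j < M then 0 else (r ^ j)⁻¹) ≤ r / (M * (r - 1)) := by
  have hr1 : 0 < r - 1 := by linarith
  have h : ∑ j ∈ Finset.range J, (if r ^ j < M then 0 else (r ^ j)⁻¹)
      ≤ max 0 (r * (M⁻¹ - (r ^ J)⁻¹)) / (r - 1) := by
    induction J with
    | zero =>
      simp only [Finset.range_zero, Finset.sum_empty]
      positivity
    | succ J ih =>
      rw [Finset.sum_range_succ]
      rw [le_div_iff₀ hr1] at ih ⊢
      have hJ : 0 < r ^ J := by positivity
      have hpow : r * (r ^ (J + 1))⁻¹ = (r ^ J)⁻¹ := by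
        rw [pow_succ]; field_simp
      have hinv : (0 : ℝ) < (r ^ J)⁻¹ := by positivity
      split_ifs with hlt
      · rw [add_zero]
        refine ih.trans (max_le_max_left _ ?_)
        rw [mul_sub, mul_sub, hpow]
        nlinarith
      · have h0 : (r ^ J)⁻¹ ≤ M⁻¹ := inv_anti₀ hM (not_lt.mp hlt)
        rw [max_eq_right (mul_nonneg (by linarith) (by linarith))] at ih
        refine le_trans ?_ (le_max_right _ _)
        rw [mul_sub r, hpow]
        nlinarith
  refine h.trans ?_
  have : max 0 (r * (M⁻¹ - (r ^ J)⁻¹)) ≤ r * M⁻¹ := by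
    have hinv : (0 : ℝ) < (r ^ J)⁻¹ := by positivity
    refine max_le (by positivity) ?_
    gcongr
    linarith
  calc _ ≤ r * M⁻¹ / (r - 1) := by gcongr
    _ = _ := by field_simp

/-- The sum over dyadic blocks of the expected excesses of the walk over the bonus. -/
lemma sum_block_le {M : ℝ} (hM : 0 < M) (J : ℕ) :
    ∑ j ∈ Finset.range J, 1 / (2 * (M * √√2 ^ j)) * exp (-((M * √√2 ^ j) ^ 2 / 2 ^ j))
      ≤ 6.3 / M ^ 2 := by
  set r : ℝ := √√2 with hr
  have hr4 : r ^ 4 = 2 := sqrt_sqrt_pow_four (by norm_num)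
  have hr0 : 0 ≤ r := sqrt_nonneg _
  -- Precise enough for `r / (r - 1) ≤ 6.3`, since `1.189 / 0.189 < 6.3`.
  have hr1 : 1.189 < r := by
    by_contra! hle
    have := pow_le_pow_left₀ hr0 hle 4
    rw [hr4] at this
    norm_num at this
  -- The exponent is `-w` with `w = M^2 / r^(2j)`. While `r ^ j < M`, the bound `exp (-w) ≤ 1 / w`
  -- leaves an increasing geometric term; afterwards `exp (-w) ≤ 1` leaves a decreasing one.
  have hterm : ∀ j : ℕ, 1 / (2 * (M * r ^ j)) * exp (-((M * r ^ j) ^ 2 / 2 ^ j))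
      ≤ 1 / (2 * M) * (if r ^ j < M then 0 else (r ^ j)⁻¹)
        + 1 / (2 * M ^ 3) * (if r ^ j < M then r ^ j else 0) := by
    intro j
    have hj : 0 < r ^ j := by positivity
    split_ifs with h
    · have h2 : (2 : ℝ) ^ j = (r ^ j) ^ 4 := by rw [← hr4, ← pow_mul, ← pow_mul, mul_comm]
      set w := (M * r ^ j) ^ 2 / 2 ^ j with hw
      have hw' : w = M ^ 2 / (r ^ j) ^ 2 := by
        rw [hw, h2]; field_simp
      have hwpos : 0 < w := by rw [hw']; positivity
      have he : exp (-w) ≤ w⁻¹ := by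
        rw [exp_neg]
        exact inv_anti₀ hwpos (by linarith [add_one_le_exp w])
      calc 1 / (2 * (M * r ^ j)) * exp (-w) ≤ 1 / (2 * (M * r ^ j)) * w⁻¹ := by gcongr
        _ = 1 / (2 * M) * 0 + 1 / (2 * M ^ 3) * r ^ j := by
          rw [hw']; field_simp; ring
    · calc 1 / (2 * (M * r ^ j)) * exp (-((M * r ^ j) ^ 2 / 2 ^ j))
          ≤ 1 / (2 * (M * r ^ j)) * 1 := by
            gcongr
            rw [exp_le_one_iff, neg_nonpos]
            positivity
        _ = 1 / (2 * M) * (r ^ j)⁻¹ + 1 / (2 * M ^ 3) * 0 := by field_simp; ring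
  calc _ ≤ ∑ j ∈ Finset.range J, (1 / (2 * M) * (if r ^ j < M then 0 else (r ^ j)⁻¹)
        + 1 / (2 * M ^ 3) * (if r ^ j < M then r ^ j else 0)) :=
        Finset.sum_le_sum fun j _ => hterm j
    _ ≤ 1 / (2 * M) * (r / (M * (r - 1))) + 1 / (2 * M ^ 3) * (r * M / (r - 1)) := by
        rw [Finset.sum_add_distrib, ← Finset.mul_sum, ← Finset.mul_sum]
        gcongr
        · exact sum_inv_pow_ge_le (by linarith) hM J
        · exact sum_pow_lt_le (by linarith) hM J
    _ = r / (r - 1) / M ^ 2 := by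
        have : r - 1 ≠ 0 := by linarith
        field_simp; ring
    _ ≤ 6.3 / M ^ 2 := by
        gcongr
        rw [div_le_iff₀ (by linarith)]
        linarith

end Series

/-! ### Pathwise control of the index by excesses -/

section

open Real

variable {Θ Ω : Type*} [MeasurableSpace Θ] [MeasurableSpace Ω] {K : ℕ}
  {P : Measure Ω} [IsProbabilityMeasure P] {π₀ : Measure Θ} [IsProbabilityMeasure π₀]
  {ν : Fin K → Kernel Θ ℝ} [∀ i, IsMarkovKernel (ν i)]
  {θ : Ω → Θ} {X : Fin K → ℕ → Ω → ℝ}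

/-- The empirical mean of the first `s` rewards of arm `i` (zero when `s = 0`). -/
noncomputable def empMean (X : Fin K → ℕ → Ω → ℝ) (i : Fin K) (s : ℕ) (ω : Ω) : ℝ :=
  (∑ k ∈ Finset.range s, X i k ω) / s

lemma IsEnvironment.meanReward_mem_Icc (hEnv : IsEnvironment P π₀ ν θ X) (i : Fin K) (x : Θ) :
    meanReward ν i x ∈ Set.Icc (0 : ℝ) 1 := by
  have hae : ∀ᵐ y ∂(ν i x), y ∈ Set.Icc (0 : ℝ) 1 := by
    have := hEnv.supported i x
    rw [← prob_compl_eq_zero_iff measurableSet_Icc] at this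
    exact this
  constructor
  · exact integral_nonneg_of_ae (hae.mono fun y hy => hy.1)
  · have := integral_mono_ae (Integrable.of_mem_Icc 0 1 aemeasurable_id hae)
      (integrable_const (1 : ℝ)) (hae.mono fun y hy => hy.2)
    rw [integral_const, probReal_univ, one_smul] at this
    exact this

lemma IsEnvironment.ae_reward_mem_Icc (hEnv : IsEnvironment P π₀ ν θ X) :
    ∀ᵐ ω ∂P, ∀ i s, X i s ω ∈ Set.Icc (0 : ℝ) 1 := by
  rw [ae_all_iff]; intro i
  rw [ae_all_iff]; intro s
  have h := hEnv.cond_iid i (s + 1) Set.univ (fun _ => Set.Icc 0 1) MeasurableSet.univ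
    (fun _ => measurableSet_Icc)
  simp only [hEnv.supported, Finset.prod_const_one, setLIntegral_const, measure_univ, mul_one,
    Set.mem_univ, true_and] at h
  have hX := hEnv.measurable_reward
  have hset : MeasurableSet {ω | ∀ k : Fin (s + 1), X i k ω ∈ Set.Icc (0 : ℝ) 1} := by
    simp only [Set.ofPred_forall]
    exact MeasurableSet.iInter fun k => hX i k measurableSet_Icc
  rw [← prob_compl_eq_zero_iff hset] at h
  have h' : ∀ᵐ ω ∂P, ∀ k : Fin (s + 1), X i k ω ∈ Set.Icc (0 : ℝ) 1 := h
  filter_upwards [h'] with ω hω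
  exact hω (Fin.last s)

lemma abs_empMean_le_one {ω : Ω} (h : ∀ i s, X i s ω ∈ Set.Icc (0 : ℝ) 1) (i : Fin K) (s : ℕ) :
    |empMean X i s ω| ≤ 1 := by
  have h0 : 0 ≤ ∑ k ∈ Finset.range s, X i k ω := Finset.sum_nonneg fun k _ => (h i k).1
  have h1 : ∑ k ∈ Finset.range s, X i k ω ≤ s := by
    simpa using Finset.sum_le_sum fun k (_ : k ∈ Finset.range s) => (h i k).2
  unfold empMean
  rw [abs_of_nonneg (by positivity)]
  exact div_le_one_of_le₀ h1 (by positivity)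

/-- The optimal arm is overestimated by its index up to a sum of block excesses. -/
lemma IsEnvironment.meanReward_sub_index_le (hEnv : IsEnvironment P π₀ ν θ X) {M : ℝ}
    (hM : 0 < M) (i : Fin K) {n s : ℕ} (hs : s < n) (ω : Ω) :
    meanReward ν i (θ ω) - (empMean X i s ω + bonus M s)
      ≤ ∑ j ∈ Finset.range n, 1 / (2 * (M * √√2 ^ j)) *
        armExcess ν θ X i n (-(2 * (M * √√2 ^ j) / 2 ^ j)) ((M * √√2 ^ j) ^ 2 / 2 ^ j) ω := by
  have hnn : ∀ j ∈ Finset.range n, 0 ≤ 1 / (2 * (M * √√2 ^ j)) *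
      armExcess ν θ X i n (-(2 * (M * √√2 ^ j) / 2 ^ j)) ((M * √√2 ^ j) ^ 2 / 2 ^ j) ω :=
    fun j _ => mul_nonneg (by positivity) (armExcess_nonneg _ _ _ _ _)
  rcases Nat.eq_zero_or_pos s with rfl | hs0
  -- For an unpulled arm the empirical mean is `0` and the bonus `1`, so the index dominates any
  -- mean in `[0,1]`.
  · refine le_trans ?_ (Finset.sum_nonneg hnn)
    have := (hEnv.meanReward_mem_Icc i (θ ω)).2
    simp [empMean, bonus, this]
  set j := Nat.log 2 s with hj
  have hjn : j ∈ Finset.range n := Finset.mem_range.mpr ((Nat.log_le_self 2 s).trans_lt hs)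
  refine le_trans ?_ (Finset.single_le_sum hnn hjn)
  have hL1 : (2 : ℝ) ^ j ≤ s := by exact_mod_cast Nat.pow_log_le_self 2 hs0.ne'
  have hL2 : (s : ℝ) < 2 * 2 ^ j := by
    have := Nat.lt_pow_succ_log_self (b := 2) (by norm_num) s
    rw [← hj, Nat.succ_eq_add_one, pow_succ, mul_comm] at this
    exact_mod_cast this
  set L : ℝ := 2 ^ j with hL
  have hLpos : 0 < L := by positivity
  -- `a = M L^(1/4)` bounds the total bonus `s * bonus M s = M s^(1/4)` from below throughout the
  -- block `L ≤ s < 2L`.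
  set a : ℝ := M * √√2 ^ j with ha
  have hapos : 0 < a := by positivity
  have hspos : (0 : ℝ) < s := by exact_mod_cast hs0
  set E := armExcess ν θ X i n (-(2 * a / L)) (a ^ 2 / L) ω with hE
  have hE0 : 0 ≤ E := armExcess_nonneg _ _ _ _ _
  have hsum := sum_sub_le_armExcess (ν := ν) (θ := θ) (X := X) i hs.le (-(2 * a / L)) (a ^ 2 / L) ω
  rw [← hE] at hsum
  set S := ∑ k ∈ Finset.range s, X i k ω with hS
  set μ := meanReward ν i (θ ω) with hμ
  -- With tilt `-2a / L` the compensator costs at most `a^2 / L`, as does the level `z`; in `hkey`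
  -- the bonus pays for both, being worth at least `2a^2 / L`.
  have hquad : (s : ℝ) * ((-(2 * a / L)) ^ 2 / 8) ≤ a ^ 2 / L := by
    have : (s : ℝ) * ((-(2 * a / L)) ^ 2 / 8) = s * (a ^ 2 / (2 * L ^ 2)) := by
      field_simp; ring
    rw [this]
    calc (s : ℝ) * (a ^ 2 / (2 * L ^ 2)) ≤ (2 * L) * (a ^ 2 / (2 * L ^ 2)) := by gcongr
      _ = a ^ 2 / L := by field_simp
  have hp : ∀ x : ℝ, 0 ≤ x → √(x ^ j) = √x ^ j := fun x hx => by
    rw [sqrt_eq_iff_mul_self_eq (by positivity) (by positivity), ← pow_two, ← pow_mul,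
      mul_comm j 2, pow_mul, sq_sqrt hx]
  have hx : √√L = √√2 ^ j := by
    rw [hL, hp 2 (by norm_num), hp √2 (sqrt_nonneg _)]
  have hbonus : a ≤ s * bonus M s := by
    have hv : 0 < √√(s : ℝ) := sqrt_pos.mpr (sqrt_pos.mpr hspos)
    have h4 := sqrt_sqrt_pow_four hspos.le
    have : (s : ℝ) * bonus M s = M * √√(s : ℝ) := by
      rw [bonus, if_neg hs0.ne']
      nth_rewrite 1 [← h4]
      field_simp
    rw [this, ha, ← hx]
    gcongr
  have hkey : 2 * a / L * (s * (μ - (S / s + bonus M s))) ≤ E := by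
    have h1 : (s : ℝ) * (μ - (S / s + bonus M s)) = s * μ - S - s * bonus M s := by
      field_simp; ring
    have h2 : 2 * a / L * a ≤ 2 * a / L * (s * bonus M s) := by gcongr
    have h3 : 2 * a / L * a = 2 * (a ^ 2 / L) := by ring
    rw [h1]
    linarith
  change μ - (S / s + bonus M s) ≤ _
  -- Replacing `s` by the smaller `L` is legitimate only when the gap is positive.
  rcases le_or_gt (μ - (S / s + bonus M s)) 0 with hneg | hpos
  · exact hneg.trans (by positivity)
  · have : 2 * a / L * (L * (μ - (S / s + bonus M s)))
        ≤ 2 * a / L * (s * (μ - (S / s + bonus M s))) := by gcongr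
    have h5 : 2 * a / L * (L * (μ - (S / s + bonus M s)))
        = 2 * a * (μ - (S / s + bonus M s)) := by field_simp
    rw [one_div, ← div_eq_inv_mul, le_div_iff₀ (by positivity)]
    linarith

/-- The tilt `2 / √s` makes the compensator exactly `1/2` after `s` steps, which the `-1/2` in the
level cancels. -/
lemma empMean_sub_le (i : Fin K) {N s : ℕ} (hsN : s ≤ N) (hs : 0 < s) (ε : ℝ) (ω : Ω) :
    empMean X i s ω - meanReward ν i (θ ω) ≤ ε + 1 / (2 * √(s : ℝ)) *
      armExcess ν θ X i N (2 / √(s : ℝ)) (2 * ε * √(s : ℝ) - 1 / 2) ω := by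
  have hspos : (0 : ℝ) < s := by exact_mod_cast hs
  have hsum := sum_sub_le_armExcess (ν := ν) (θ := θ) (X := X) i hsN (2 / √(s : ℝ))
    (2 * ε * √(s : ℝ) - 1 / 2) ω
  set E := armExcess ν θ X i N (2 / √(s : ℝ)) (2 * ε * √(s : ℝ) - 1 / 2) ω
  rw [empMean]
  set S := ∑ k ∈ Finset.range s, X i k ω
  set μ := meanReward ν i (θ ω)
  set u := √(s : ℝ) with hu
  have hupos : 0 < u := sqrt_pos.mpr hspos
  have hu2 : (s : ℝ) = u ^ 2 := (sq_sqrt hspos.le).symm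
  rw [hu2] at hsum ⊢
  have h1 : 2 / u * (S - u ^ 2 * μ) - u ^ 2 * ((2 / u) ^ 2 / 8) - (2 * ε * u - 1 / 2)
      = 2 * u * (S / u ^ 2 - μ - ε) := by
    field_simp; ring
  rw [h1] at hsum
  have h2 : S / u ^ 2 - μ - ε ≤ 1 / (2 * u) * E := by
    rw [one_div, ← div_eq_inv_mul, le_div_iff₀ (by positivity)]
    linarith
  linarith

/-- The excess sum is extended to the fixed range `n`, so that its expectation can be taken although
`N` will be a random pull count. -/
lemma IsEnvironment.sum_index_sub_le (hEnv : IsEnvironment P π₀ ν θ X) {M : ℝ} (hM : 0 < M)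
    (i : Fin K) {n N : ℕ} (hN : N ≤ n) {ε : ℝ} (hε : 0 ≤ ε) (ω : Ω) :
    ∑ s ∈ Finset.range N, (empMean X i s ω + bonus M s - meanReward ν i (θ ω))
      ≤ 1 + 3 * M ^ 2 + N / M ^ 2 + N * ε + ∑ s ∈ Finset.range n, 1 / (2 * √(s : ℝ)) *
        armExcess ν θ X i n (2 / √(s : ℝ)) (2 * ε * √(s : ℝ) - 1 / 2) ω := by
  have hnn : ∀ s ∈ Finset.range n, 0 ≤ 1 / (2 * √(s : ℝ)) *
      armExcess ν θ X i n (2 / √(s : ℝ)) (2 * ε * √(s : ℝ) - 1 / 2) ω :=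
    fun s _ => mul_nonneg (by positivity) (armExcess_nonneg _ _ _ _ _)
  have hterm : ∀ s ∈ Finset.range N, empMean X i s ω + bonus M s - meanReward ν i (θ ω)
      ≤ bonus M s + ε + 1 / (2 * √(s : ℝ)) *
        armExcess ν θ X i n (2 / √(s : ℝ)) (2 * ε * √(s : ℝ) - 1 / 2) ω := by
    intro s hs
    rw [Finset.mem_range] at hs
    rcases Nat.eq_zero_or_pos s with rfl | hs0
    · have := (hEnv.meanReward_mem_Icc i (θ ω)).1
      simp only [empMean, Finset.range_zero, Finset.sum_empty, Nat.cast_zero, div_zero, sqrt_zero,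
        mul_zero, zero_mul]
      linarith
    · have := empMean_sub_le (ν := ν) (θ := θ) (X := X) i (hs.le.trans hN) hs0 ε ω
      linarith
  refine (Finset.sum_le_sum hterm).trans ?_
  rw [Finset.sum_add_distrib, Finset.sum_add_distrib, Finset.sum_const, Finset.card_range,
    nsmul_eq_mul]
  have h1 := sum_bonus_le hM N
  have h2 := Finset.sum_le_sum_of_subset_of_nonneg (Finset.range_mono hN)
    fun s hs _ => hnn s hs
  linarith

end

/-! ### Posterior matching and the regret decomposition -/

section

open Real

variable {Θ Ω : Type*} [MeasurableSpace Θ] [MeasurableSpace Ω] {K : ℕ}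
  {P : Measure Ω} [IsProbabilityMeasure P] {π₀ : Measure Θ} [IsProbabilityMeasure π₀]
  {ν : Fin K → Kernel Θ ℝ} [∀ i, IsMarkovKernel (ν i)]
  {θ : Ω → Θ} {X : Fin K → ℕ → Ω → ℝ}
  {best : Θ → Fin K} {post : (t : ℕ) → Kernel (Fin t → Fin K × ℝ) Θ} [∀ t, IsMarkovKernel (post t)]
  {draw : ℕ → Ω → Θ} {I : ℕ → Ω → Fin K}

/-- The upper confidence index of arm `i`, read off from a history of `t` rounds. -/
noncomputable def ucbIndex (M : ℝ) (t : ℕ) (i : Fin K) (h : Fin t → Fin K × ℝ) : ℝ :=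
  (∑ s, if (h s).1 = i then (h s).2 else 0) / ((Finset.univ.filter fun s => (h s).1 = i).card : ℝ)
    + bonus M (Finset.univ.filter fun s => (h s).1 = i).card

lemma measurable_ucbIndex (M : ℝ) (t : ℕ) (i : Fin K) : Measurable (ucbIndex M t i) := by
  have hset : ∀ s : Fin t, MeasurableSet {h : Fin t → Fin K × ℝ | (h s).1 = i} := fun s =>
    (measurable_fst.comp (measurable_pi_apply s)) (measurableSet_singleton i)
  have hcard : Measurable fun h : Fin t → Fin K × ℝ =>
      (Finset.univ.filter fun s => (h s).1 = i).card := by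
    simp only [Finset.card_filter]
    exact Finset.measurable_sum _ fun s _ =>
      Measurable.ite (hset s) measurable_const measurable_const
  refine Measurable.add (Measurable.div ?_ ?_) ?_
  · exact Finset.measurable_sum _ fun s _ =>
      Measurable.ite (hset s) (by fun_prop) measurable_const
  · exact (measurable_from_nat (f := fun k : ℕ => (k : ℝ))).comp hcard
  · exact (measurable_from_nat (f := bonus M)).comp hcard

lemma ucbIndex_history (M : ℝ) (t : ℕ) (i : Fin K) (ω : Ω) :
    ucbIndex M t i (history X I t ω)
      = empMean X i (pulls I i t ω) ω + bonus M (pulls I i t ω) := by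
  have hcard : (Finset.univ.filter fun s => (history X I t ω s).1 = i).card = pulls I i t ω := by
    rw [pulls, Finset.card_filter, Finset.card_filter]
    exact Fin.sum_univ_eq_sum_range (fun s => if I s ω = i then 1 else 0) t
  rw [ucbIndex, hcard, empMean, ← sum_received]
  congr 2
  exact Fin.sum_univ_eq_sum_range (fun s => if I s ω = i then received X I s ω else 0) t

lemma IsThompsonSampling.measurable_pull (hTS : IsThompsonSampling P ν θ X best post draw I)
    (t : ℕ) : Measurable (I t) := by
  have h : I t = best ∘ draw t := funext fun ω => hTS.pull t ω
  rw [h]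
  exact hTS.measurable_best.comp (hTS.measurable_draw t)

/-- Given the history, the sampled parameter has the same law as the true one. -/
lemma IsThompsonSampling.map_history_draw (hTS : IsThompsonSampling P ν θ X best post draw I)
    (t : ℕ) : P.map (fun ω => (history X I t ω, draw t ω))
      = P.map (fun ω => (history X I t ω, θ ω)) := by
  have h1 := (hTS.posterior t).map_eq
  have h2 := (hTS.sampling t).comp_right.map_eq
  exact h2.trans h1.symm

/-- Both sides integrate the same function of history and parameter, against joint laws that agree.
-/
lemma IsThompsonSampling.integral_index_eq (hTS : IsThompsonSampling P ν θ X best post draw I)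
    (M : ℝ) (t : ℕ) :
    ∫ ω, ucbIndex M t (best (θ ω)) (history X I t ω) ∂P
      = ∫ ω, ucbIndex M t (I t ω) (history X I t ω) ∂P := by
  have hf : Measurable fun p : (Fin t → Fin K × ℝ) × Θ => ucbIndex M t (best p.2) p.1 := by
    have h : Measurable fun q : (Fin t → Fin K × ℝ) × Fin K => ucbIndex M t q.2 q.1 :=
      measurable_from_prod_countable_left fun i => measurable_ucbIndex M t i
    exact h.comp (measurable_fst.prodMk (hTS.measurable_best.comp measurable_snd))
  have h1 := integral_map (hTS.posterior t).aemeasurable (f := fun p => ucbIndex M t (best p.2) p.1)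
    hf.aestronglyMeasurable
  have h2 := integral_map (μ := P) (φ := fun ω => (history X I t ω, draw t ω))
    (hTS.sampling t).comp_right.aemeasurable (f := fun p => ucbIndex M t (best p.2) p.1)
    hf.aestronglyMeasurable
  simp only [hTS.pull]
  rw [← h1, ← hTS.map_history_draw, h2]

lemma integrable_choice {Ω' ι : Type*} [MeasurableSpace Ω'] {Q : Measure Ω'} [Fintype ι]
    [MeasurableSpace ι] [MeasurableSingletonClass ι] {f : ι → Ω' → ℝ}
    (hf : ∀ i, Integrable (f i) Q) {J : Ω' → ι} (hJ : Measurable J) :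
    Integrable (fun ω => f (J ω) ω) Q := by
  have heq : (fun ω => f (J ω) ω) = fun ω => ∑ i, (J ⁻¹' {i}).indicator (f i) ω := by
    ext ω
    rw [Finset.sum_eq_single (J ω) (fun i _ hi => Set.indicator_of_notMem (by simpa using hi.symm) _)
      (by simp), Set.indicator_of_mem (by simp)]
  rw [heq]
  exact integrable_finsetSum _ fun i _ => (hf i).indicator (hJ (measurableSet_singleton i))

lemma IsEnvironment.integrable_index (hEnv : IsEnvironment P π₀ ν θ X)
    (hTS : IsThompsonSampling P ν θ X best post draw I) {M : ℝ} (hM : 0 ≤ M) (t : ℕ)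
    (i : Fin K) : Integrable (fun ω => ucbIndex M t i (history X I t ω)) P := by
  have hH : AEMeasurable (history X I t) P := (hTS.posterior t).aemeasurable_fst
  refine Integrable.of_bound ((measurable_ucbIndex M t i).comp_aemeasurable hH).aestronglyMeasurable
    (2 + M) ?_
  filter_upwards [hEnv.ae_reward_mem_Icc] with ω hω
  rw [ucbIndex_history, norm_eq_abs]
  have h1 := abs_empMean_le_one hω i (pulls I i t ω)
  have h2 := bonus_le hM (pulls I i t ω)
  have h3 := bonus_nonneg hM (pulls I i t ω)
  refine (abs_add_le _ _).trans ?_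
  rw [abs_of_nonneg h3]
  linarith

lemma IsEnvironment.integrable_meanReward (hEnv : IsEnvironment P π₀ ν θ X) (i : Fin K) :
    Integrable (fun ω => meanReward ν i (θ ω)) P :=
  Integrable.of_mem_Icc 0 1 ((measurable_meanReward ν i).comp hEnv.measurable_param).aemeasurable
    (ae_of_all _ fun ω => hEnv.meanReward_mem_Icc i (θ ω))

lemma IsThompsonSampling.iSup_meanReward (hTS : IsThompsonSampling P ν θ X best post draw I)
    (x : Θ) : ⨆ i, meanReward ν i x = meanReward ν (best x) x := by
  have : Nonempty (Fin K) := ⟨best x⟩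
  exact le_antisymm (ciSup_le fun i => hTS.best_optimal x i)
    (le_ciSup (Set.finite_range fun i => meanReward ν i x).bddAbove (best x))

/-- The regret is the sum of how much the index underestimates the optimal arm and how much it
overestimates the arm that is pulled. -/
lemma IsThompsonSampling.bayesRegret_eq (hEnv : IsEnvironment P π₀ ν θ X)
    (hTS : IsThompsonSampling P ν θ X best post draw I) {M : ℝ} (hM : 0 ≤ M) (n : ℕ) :
    bayesRegret P ν θ I n
      = ∑ t ∈ Finset.range n, ∫ ω, (meanReward ν (best (θ ω)) (θ ω)
          - ucbIndex M t (best (θ ω)) (history X I t ω)) ∂P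
        + ∫ ω, ∑ t ∈ Finset.range n, (ucbIndex M t (I t ω) (history X I t ω)
          - meanReward ν (I t ω) (θ ω)) ∂P := by
  have hbθ : Measurable fun ω => best (θ ω) := hTS.measurable_best.comp hEnv.measurable_param
  have i1 := integrable_choice (fun i => hEnv.integrable_meanReward i) hbθ
  have i2 := fun t => integrable_choice (fun i => hEnv.integrable_meanReward i)
    (hTS.measurable_pull t)
  have i3 := fun t => integrable_choice (fun i => hEnv.integrable_index hTS hM t i) hbθ
  have i4 := fun t => integrable_choice (fun i => hEnv.integrable_index hTS hM t i)
    (hTS.measurable_pull t)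
  simp only [bayesRegret, hTS.iSup_meanReward]
  have i5 : ∀ t ∈ Finset.range n, Integrable (fun ω => meanReward ν (best (θ ω)) (θ ω)
      - meanReward ν (I t ω) (θ ω)) P := fun t _ => i1.sub (i2 t)
  have i6 : ∀ t ∈ Finset.range n, Integrable (fun ω => ucbIndex M t (I t ω) (history X I t ω)
      - meanReward ν (I t ω) (θ ω)) P := fun t _ => (i4 t).sub (i2 t)
  rw [integral_finsetSum _ i5, integral_finsetSum _ i6, ← Finset.sum_add_distrib]
  refine Finset.sum_congr rfl fun t _ => ?_
  rw [integral_sub i1 (i2 t), integral_sub i1 (i3 t), integral_sub (i4 t) (i2 t),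
    hTS.integral_index_eq M t]
  ring

lemma IsEnvironment.integral_meanReward_sub_index_le (hEnv : IsEnvironment P π₀ ν θ X)
    (hTS : IsThompsonSampling P ν θ X best post draw I) {M : ℝ} (hM : 0 < M) {n t : ℕ}
    (ht : t < n) :
    ∫ ω, (meanReward ν (best (θ ω)) (θ ω)
      - ucbIndex M t (best (θ ω)) (history X I t ω)) ∂P ≤ 6.3 / M ^ 2 := by
  have hbθ : Measurable fun ω => best (θ ω) := hTS.measurable_best.comp hEnv.measurable_param
  have hE := fun j : ℕ => hEnv.integral_armExcess_choice_le hTS.measurable_best n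
    (-(2 * (M * √√2 ^ j) / 2 ^ j)) ((M * √√2 ^ j) ^ 2 / 2 ^ j)
  have hint : ∀ j ∈ Finset.range n, Integrable (fun ω => 1 / (2 * (M * √√2 ^ j)) *
      armExcess ν θ X (best (θ ω)) n (-(2 * (M * √√2 ^ j) / 2 ^ j))
        ((M * √√2 ^ j) ^ 2 / 2 ^ j) ω) P := fun j _ => (hE j).1.const_mul _
  calc _ ≤ ∫ ω, ∑ j ∈ Finset.range n, 1 / (2 * (M * √√2 ^ j)) *
        armExcess ν θ X (best (θ ω)) n (-(2 * (M * √√2 ^ j) / 2 ^ j))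
          ((M * √√2 ^ j) ^ 2 / 2 ^ j) ω ∂P := by
        refine integral_mono
          ((integrable_choice (fun i => hEnv.integrable_meanReward i) hbθ).sub
            (integrable_choice (fun i => hEnv.integrable_index hTS hM.le t i) hbθ))
          (integrable_finsetSum _ hint) fun ω => ?_
        simp only [ucbIndex_history]
        exact hEnv.meanReward_sub_index_le hM _ ((pulls_le I _ t ω).trans_lt ht) ω
    _ ≤ ∑ j ∈ Finset.range n,
        1 / (2 * (M * √√2 ^ j)) * exp (-((M * √√2 ^ j) ^ 2 / 2 ^ j)) := by
        rw [integral_finsetSum _ hint]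
        refine Finset.sum_le_sum fun j _ => ?_
        rw [integral_const_mul]
        exact mul_le_mul_of_nonneg_left (hE j).2 (by positivity)
    _ ≤ 6.3 / M ^ 2 := sum_block_le hM n

/-- After regrouping by arm, the bonuses give the terms with `M`, the slack `ε` costs `n * ε`, and
the excesses of each arm sum to the last term by `sum_exp_neg_sqrt_le` with `a = 2ε`. -/
lemma IsEnvironment.integral_sum_index_sub_le (hEnv : IsEnvironment P π₀ ν θ X)
    (hTS : IsThompsonSampling P ν θ X best post draw I) {M : ℝ} (hM : 0 < M) (n : ℕ)
    {ε : ℝ} (hε : 0 < ε) :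
    ∫ ω, ∑ t ∈ Finset.range n, (ucbIndex M t (I t ω) (history X I t ω)
      - meanReward ν (I t ω) (θ ω)) ∂P
      ≤ K * (1 + 3 * M ^ 2) + n / M ^ 2 + n * ε + K * (exp (1 / 2) / (2 * ε)) := by
  have hint : ∀ i : Fin K, ∀ s ∈ Finset.range n, Integrable (fun ω => 1 / (2 * √(s : ℝ)) *
      armExcess ν θ X i n (2 / √(s : ℝ)) (2 * ε * √(s : ℝ) - 1 / 2) ω) P :=
    fun i s _ => (hEnv.integrable_armExcess i n _ _).const_mul _
  have hint' : Integrable (fun ω => ∑ i : Fin K, ∑ s ∈ Finset.range n, 1 / (2 * √(s : ℝ)) *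
      armExcess ν θ X i n (2 / √(s : ℝ)) (2 * ε * √(s : ℝ) - 1 / 2) ω) P :=
    integrable_finsetSum _ fun i _ => integrable_finsetSum _ (hint i)
  calc _ ≤ ∫ ω, (K * (1 + 3 * M ^ 2) + n / M ^ 2 + n * ε + ∑ i : Fin K, ∑ s ∈ Finset.range n,
        1 / (2 * √(s : ℝ)) *
        armExcess ν θ X i n (2 / √(s : ℝ)) (2 * ε * √(s : ℝ) - 1 / 2) ω) ∂P := by
        refine integral_mono (integrable_finsetSum _ fun t _ =>
          (integrable_choice (fun i => hEnv.integrable_index hTS hM.le t i)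
            (hTS.measurable_pull t)).sub
          (integrable_choice (fun i => hEnv.integrable_meanReward i) (hTS.measurable_pull t)))
          ((integrable_const _).add hint') fun ω => ?_
        simp only [ucbIndex_history]
        rw [sum_range_pulls I ω
          (fun i s => empMean X i s ω + bonus M s - meanReward ν i (θ ω)) n]
        refine (Finset.sum_le_sum fun i _ =>
          hEnv.sum_index_sub_le hM i (pulls_le I i n ω) hε.le ω).trans_eq ?_
        have hsum : ∑ i, (pulls I i n ω : ℝ) = n := by exact_mod_cast sum_pulls I ω n
        simp only [Finset.sum_add_distrib, ← Finset.sum_div, ← Finset.sum_mul, hsum,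
          Finset.sum_const, Finset.card_univ, Fintype.card_fin, nsmul_eq_mul]
        ring
    _ ≤ _ := by
        rw [integral_add (integrable_const _) hint', integral_const, probReal_univ, one_smul,
          integral_finsetSum _ fun i _ => integrable_finsetSum _ (hint i)]
        gcongr
        have hi : ∀ i : Fin K, ∫ ω, ∑ s ∈ Finset.range n, 1 / (2 * √(s : ℝ)) *
            armExcess ν θ X i n (2 / √(s : ℝ)) (2 * ε * √(s : ℝ) - 1 / 2) ω ∂P
            ≤ exp (1 / 2) / (2 * ε) := by
          intro i
          rw [integral_finsetSum _ (hint i)]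
          calc _ ≤ ∑ s ∈ Finset.range n,
                exp (1 / 2) * (1 / (2 * √(s : ℝ)) * exp (-(2 * ε * √(s : ℝ)))) := by
                refine Finset.sum_le_sum fun s _ => ?_
                rw [integral_const_mul]
                refine (mul_le_mul_of_nonneg_left (hEnv.integral_armExcess_le i n _ _)
                  (by positivity)).trans_eq ?_
                rw [neg_sub, sub_eq_add_neg, exp_add]
                ring
            _ ≤ exp (1 / 2) / (2 * ε) := by
                rw [← Finset.mul_sum, div_eq_mul_one_div (exp (1 / 2))]
                exact mul_le_mul_of_nonneg_left (sum_exp_neg_sqrt_le (by positivity) n)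
                  (exp_pos _).le
        refine (Finset.sum_le_sum fun i _ => hi i).trans_eq ?_
        simp

lemma IsThompsonSampling.bayesRegret_le_rounds (hEnv : IsEnvironment P π₀ ν θ X)
    (hTS : IsThompsonSampling P ν θ X best post draw I) (n : ℕ) :
    bayesRegret P ν θ I n ≤ n := by
  have hbθ : Measurable fun ω => best (θ ω) := hTS.measurable_best.comp hEnv.measurable_param
  have i1 := integrable_choice (fun i => hEnv.integrable_meanReward i) hbθ
  have i2 := fun t => integrable_choice (fun i => hEnv.integrable_meanReward i)
    (hTS.measurable_pull t)
  simp only [bayesRegret, hTS.iSup_meanReward]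
  calc _ ≤ ∫ _, (n : ℝ) ∂P := by
        refine integral_mono (integrable_finsetSum _ fun t _ => i1.sub (i2 t))
          (integrable_const _) fun ω => ?_
        refine (Finset.sum_le_sum (g := fun _ => (1 : ℝ)) fun t _ => ?_).trans_eq (by simp)
        have h1 := (hEnv.meanReward_mem_Icc (best (θ ω)) (θ ω)).2
        have h2 := (hEnv.meanReward_mem_Icc (I t ω) (θ ω)).1
        linarith
    _ = n := by simp

end

end BayesBandit

theorem theorem1 {Θ Ω : Type*} [MeasurableSpace Θ] [MeasurableSpace Ω] {K : ℕ}
    (P : Measure Ω) [IsProbabilityMeasure P]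
    (π₀ : Measure Θ) [IsProbabilityMeasure π₀]
    (ν : Fin K → Kernel Θ ℝ) [∀ i, IsMarkovKernel (ν i)]
    (θ : Ω → Θ) (X : Fin K → ℕ → Ω → ℝ)
    (hEnv : BayesBandit.IsEnvironment P π₀ ν θ X)
    (best : Θ → Fin K) (post : (t : ℕ) → Kernel (Fin t → Fin K × ℝ) Θ)
    [∀ t, IsMarkovKernel (post t)]
    (draw : ℕ → Ω → Θ) (I : ℕ → Ω → Fin K)
    (hTS : BayesBandit.IsThompsonSampling P ν θ X best post draw I)
    (n : ℕ) :
    BayesBandit.bayesRegret P ν θ I n ≤ 14 * Real.sqrt (n * K) := by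
  rcases lt_or_ge n K with hnK | hKn
  -- With fewer rounds than arms, one unit of regret per round already gives `n ≤ √(nK)`.
  · refine (hTS.bayesRegret_le_rounds hEnv n).trans ?_
    have h1 : (n : ℝ) ≤ Real.sqrt (n * K) := by
      refine Real.le_sqrt_of_sq_le ?_
      rw [pow_two]
      gcongr
    linarith [Real.sqrt_nonneg ((n : ℝ) * K)]
  · have hK : 0 < K := by
      obtain ⟨ω⟩ := nonempty_of_isProbabilityMeasure P
      exact (best (θ ω)).pos
    have hKr : (0 : ℝ) < K := by exact_mod_cast hK
    have hnr : (0 : ℝ) < n := by exact_mod_cast hK.trans_le hKn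
    -- This value balances the two parts: `K M^2 = n / M^2 = R`.
    set M : ℝ := Real.sqrt (Real.sqrt (n / K)) with hM
    set R : ℝ := Real.sqrt (n * K) with hR
    have hMpos : 0 < M := Real.sqrt_pos.mpr (Real.sqrt_pos.mpr (by positivity))
    have hM4 : M ^ 4 = n / K := BayesBandit.sqrt_sqrt_pow_four (by positivity)
    have hKM : K * M ^ 2 = R := by
      rw [hR, eq_comm, Real.sqrt_eq_iff_mul_self_eq (by positivity) (by positivity)]
      have : (K * M ^ 2) * (K * M ^ 2) = (K : ℝ) ^ 2 * M ^ 4 := by ring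
      rw [this, hM4]
      field_simp
    have hnM : n / M ^ 2 = R := by
      rw [← hKM, div_eq_iff (by positivity)]
      have : (K : ℝ) * M ^ 2 * M ^ 2 = K * M ^ 4 := by ring
      rw [this, hM4]
      field_simp
    -- Here `K ≤ n` is needed: it absorbs the unit bonus of each arm's first pull.
    have hKR : K ≤ R := by
      refine Real.le_sqrt_of_sq_le ?_
      rw [pow_two]
      gcongr
    have hexp : Real.exp (1 / 2) ≤ 1.65 := by
      have h1 : Real.exp (1 / 2) ^ 2 = Real.exp 1 := by
        rw [← Real.exp_nat_mul]; norm_num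
      have h2 := Real.exp_one_lt_d9
      refine abs_le_of_sq_le_sq' ?_ (by norm_num) |>.2
      rw [h1]
      norm_num at h2 ⊢
      linarith
    have hε : (0 : ℝ) < 1 / M ^ 2 := by positivity
    rw [hTS.bayesRegret_eq hEnv hMpos.le n]
    have hfirst := Finset.sum_le_sum fun t (ht : t ∈ Finset.range n) =>
      hEnv.integral_meanReward_sub_index_le hTS hMpos (Finset.mem_range.mp ht)
    have hsecond := hEnv.integral_sum_index_sub_le hTS hMpos n hε
    rw [Finset.sum_const, Finset.card_range, nsmul_eq_mul] at hfirst
    have e1 : (n : ℝ) * (6.3 / M ^ 2) = 6.3 * R := by rw [← hnM]; ring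
    have e2 : (n : ℝ) * (1 / M ^ 2) = R := by rw [← hnM]; ring
    have e3 : (K : ℝ) * (Real.exp (1 / 2) / (2 * (1 / M ^ 2))) = Real.exp (1 / 2) * R / 2 := by
      rw [← hKM]; field_simp
    have e4 : (K : ℝ) * (1 + 3 * M ^ 2) = K + 3 * R := by rw [← hKM]; ring
    rw [e1] at hfirst
    rw [e2, e3, e4, hnM] at hsecond
    have hRpos : 0 < R := hKr.trans_le hKR
    have h5 := mul_le_mul_of_nonneg_right hexp hRpos.le
    -- The coefficients of `R` are `6.3` for underestimation and `1 + 3 + 1 + 1 + 0.825` for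
    -- overestimation, in total `13.125`.
    linarith
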